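/- Let $T$ be a Hausdorff topological space and let $(B_t)_{t\in T}$ be a family of $C^*$-algebras. An operator field is a map $x$ with $x(t)\in B_t$ for all $t\in T$. A \emph{full algebra of operator fields} on $T$ is a family of operator fields that is closed under all pointwise $*$-algebra operations, such that for every member $x$ the function $t\mapsto\|x(t)\|$ is continuous and vanishes at infinity, such that for each $t$ the values $x(t)$ of the members are dense in $B_t$, and which is complete in the norm $\|x\|=\sup_t\|x(t)\|$. It is \emph{maximal} if it is not properly contained in another full algebra of operator fields with the same $T$ and $(B_t)$. Let $\Gamma$ be a maximal full algebra of operator fields on $T$, and let $A$ be a unital separable $C^*$-algebra with a $*$-isomorphism $A\cong\Gamma$, $a\mapsto\hat a$. Write $\operatorname{supp}\hat a$ for the closure of $\{t:\hat a(t)\ne 0\}$, let $\Sigma$ be the algebra of subsets of $T$ generated by the closed sets, and let $A^*$ be the space of continuous linear functionals on $A$. An \emph{RBA AOFM} (regular bounded additive algebra of operator field measure) is a map $\mu:\Sigma\to A^*$ such that (i) $\mu(S\sqcup R)=\mu(S)+\mu(R)$ for disjoint $S,R\in\Sigma$; (ii) $\mu(S)(a)=0$ whenever $S\in\Sigma$,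 $a\in A$ and $\operatorname{supp}\hat a\cap S=\emptyset$; (iii) $\|\mu\|:=\sup\sum_i\|\mu(S_i)\|<\infty$, the supremum being over all finite partitions $\{S_i\}$ of $T$ into members of $\Sigma$; (iv) for all $E\in\Sigma$, $a\in A$ and $\varepsilon>0$ there are $F,G\in\Sigma$ such that the closure of $F$ is contained in $E$, $E$ is contained in the interior of $G$, and $|\mu(C)(a)|<\varepsilon$ for every $C\in\Sigma$ with $C\subset G\setminus F$. The RBA AOFM form a complex vector space under pointwise operations, normed by $\|\cdot\|$. \textbf{Theorem.} The map $\mu\mapsto\mu(T)$ is an isometric linear isomorphism of the normed space of RBA AOFM onto $A^*$. -/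

import Mathlib

open Set Filter Topology MeasureTheory
open scoped ENNReal

noncomputable section

namespace OperatorField

section FullAlgebra

/-- Full algebras of operator fields over `T` with fibres `B t`.  The ambient algebra `lp B ∞` is
the C*-algebra of all bounded operator fields `x : ∀ t, B t` with pointwise operations and the norm
`‖x‖ = ⨆ t, ‖x t‖`.  (A field whose norm function is continuous and vanishes at infinity is
bounded, so nothing is lost by working with bounded fields.) -/
structure IsFullAlgebra {T : Type*} [TopologicalSpace T] {B : T → Type*}
    [∀ t, NonUnitalCStarAlgebra (B t)] (Γ : NonUnitalStarSubalgebra ℂ (lp B ∞)) : Prop where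
  continuous_norm : ∀ x ∈ Γ, Continuous fun t => ‖x t‖
  vanishing : ∀ x ∈ Γ, Tendsto (fun t => ‖x t‖) (cocompact T) (𝓝 0)
  dense_fibre : ∀ t, Dense {b : B t | ∃ x ∈ Γ, x t = b}
  complete : IsComplete (Γ : Set (lp B ∞))

/-- A maximal full algebra of operator fields. -/
def IsMaximalFullAlgebra {T : Type*} [TopologicalSpace T] {B : T → Type*}
    [∀ t, NonUnitalCStarAlgebra (B t)] (Γ : NonUnitalStarSubalgebra ℂ (lp B ∞)) : Prop :=
  Maximal IsFullAlgebra Γ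

/-- The support of an operator field. -/
def fieldSupport {T : Type*} [TopologicalSpace T] {B : T → Type*}
    [∀ t, NonUnitalCStarAlgebra (B t)] (x : lp B ∞) : Set T :=
  closure {t | x t ≠ 0}

end FullAlgebra

/-- The algebra of subsets of `T` generated by the closed sets. -/
abbrev ClosedAlg (T : Type*) [TopologicalSpace T] : Set (Set T) :=
  generateSetAlgebra {S : Set T | IsClosed S}

namespace ClosedAlg

variable {T : Type*} [TopologicalSpace T]

theorem union_mem (S R : ClosedAlg T) : (S : Set T) ∪ R ∈ ClosedAlg T :=
  isSetAlgebra_generateSetAlgebra.union_mem S.2 R.2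

theorem inter_mem (S R : ClosedAlg T) : (S : Set T) ∩ R ∈ ClosedAlg T :=
  isSetAlgebra_generateSetAlgebra.inter_mem S.2 R.2

theorem compl_mem (S : ClosedAlg T) : (S : Set T)ᶜ ∈ ClosedAlg T :=
  isSetAlgebra_generateSetAlgebra.compl_mem S.2

theorem univ_mem : (univ : Set T) ∈ ClosedAlg T :=
  isSetAlgebra_generateSetAlgebra.univ_mem

theorem empty_mem : (∅ : Set T) ∈ ClosedAlg T :=
  isSetAlgebra_generateSetAlgebra.empty_mem

/-- The whole space as a member of the algebra. -/
def whole (T : Type*) [TopologicalSpace T] : ClosedAlg T := ⟨univ, univ_mem⟩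

end ClosedAlg

section Measures

variable {T : Type*} [TopologicalSpace T] {B : T → Type*} [∀ t, NonUnitalCStarAlgebra (B t)]
  {Γ : NonUnitalStarSubalgebra ℂ (lp B ∞)} {A : Type*} [CStarAlgebra A] {φ : A ≃⋆ₐ[ℂ] Γ}

/-- The sums `∑ ‖μ (S i)‖` over all finite partitions `(S i)` of `T` into members of the algebra
generated by the closed sets. -/
def variationSums (μ : ClosedAlg T → StrongDual ℂ A) : Set ℝ :=
  {r | ∃ (n : ℕ) (S : Fin n → ClosedAlg T),
    (∀ i j, i ≠ j → Disjoint (S i : Set T) (S j)) ∧ (⋃ i, (S i : Set T)) = univ ∧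
      r = ∑ i, ‖μ (S i)‖}

/-- Let `φ` identify `A` with the algebra of operator fields `Γ`; the field of `a` is `φ a`.
A set function on the algebra generated by the closed sets, with values in the dual of `A`, is
a regular bounded additive algebra of operator field measure (RBA AOFM). -/
structure IsRBAAOFM (φ : A ≃⋆ₐ[ℂ] Γ) (μ : ClosedAlg T → StrongDual ℂ A) : Prop where
  additive : ∀ S R : ClosedAlg T, Disjoint (S : Set T) R →
    μ ⟨S ∪ R, ClosedAlg.union_mem S R⟩ = μ S + μ R
  support : ∀ (S : ClosedAlg T) (a : A),
    fieldSupport (φ a : lp B ∞) ∩ S = ∅ → μ S a = 0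
  bounded : BddAbove (variationSums μ)
  regular : ∀ (E : ClosedAlg T) (a : A) (ε : ℝ), 0 < ε →
    ∃ F G : ClosedAlg T, closure (F : Set T) ⊆ E ∧ (E : Set T) ⊆ interior G ∧
      ∀ C : ClosedAlg T, (C : Set T) ⊆ (G : Set T) \ F → ‖μ C a‖ < ε

theorem variationSums_nonempty (μ : ClosedAlg T → StrongDual ℂ A) :
    (variationSums μ).Nonempty :=
  ⟨_, 1, fun _ => ClosedAlg.whole T, fun i j h => (h (Subsingleton.elim i j)).elim,
    iUnion_const _, rfl⟩

/-- The RBA AOFM form a linear subspace of all set functions. -/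
def rbaSubmodule (φ : A ≃⋆ₐ[ℂ] Γ) :
    Submodule ℂ (ClosedAlg T → StrongDual ℂ A) where
  carrier := {μ | IsRBAAOFM φ μ}
  zero_mem' :=
    { additive := fun _ _ _ => by simp
      support := fun _ _ _ => by simp
      bounded := ⟨0, by rintro r ⟨n, S, -, -, rfl⟩; simp⟩
      regular := fun E a ε hε =>
        ⟨⟨∅, ClosedAlg.empty_mem⟩, ClosedAlg.whole T, by simp, by simp [ClosedAlg.whole],
          fun C _ => by simpa using hε⟩ }
  add_mem' := by
    intro μ ν hμ hν
    refine ⟨fun S R h => ?_, fun S a h => ?_, ?_, fun E a ε hε => ?_⟩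
    · simp only [Pi.add_apply, hμ.additive S R h, hν.additive S R h]
      abel
    · simp [hμ.support S a h, hν.support S a h]
    · obtain ⟨c, hc⟩ := hμ.bounded
      obtain ⟨d, hd⟩ := hν.bounded
      refine ⟨c + d, ?_⟩
      rintro r ⟨n, S, h₁, h₂, rfl⟩
      have e₁ := hc ⟨n, S, h₁, h₂, rfl⟩
      have e₂ := hd ⟨n, S, h₁, h₂, rfl⟩
      calc ∑ i, ‖(μ + ν) (S i)‖ ≤ ∑ i, (‖μ (S i)‖ + ‖ν (S i)‖) :=
            Finset.sum_le_sum fun i _ => norm_add_le _ _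
        _ ≤ c + d := by rw [Finset.sum_add_distrib]; exact add_le_add e₁ e₂
    · obtain ⟨F₁, G₁, hF₁, hG₁, h₁⟩ := hμ.regular E a (ε / 2) (half_pos hε)
      obtain ⟨F₂, G₂, hF₂, hG₂, h₂⟩ := hν.regular E a (ε / 2) (half_pos hε)
      refine ⟨⟨_, ClosedAlg.union_mem F₁ F₂⟩, ⟨_, ClosedAlg.inter_mem G₁ G₂⟩, ?_, ?_, ?_⟩
      · simpa only [closure_union] using union_subset hF₁ hF₂
      · simpa only [interior_inter] using subset_inter hG₁ hG₂
      · intro C hC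
        have e₁ := h₁ C fun x hx => ⟨(hC hx).1.1, fun h => (hC hx).2 (Or.inl h)⟩
        have e₂ := h₂ C fun x hx => ⟨(hC hx).1.2, fun h => (hC hx).2 (Or.inr h)⟩
        calc ‖(μ + ν) C a‖ ≤ ‖μ C a‖ + ‖ν C a‖ := norm_add_le _ _
          _ < ε := by linarith
  smul_mem' := by
    intro c μ hμ
    refine ⟨fun S R h => ?_, fun S a h => ?_, ?_, fun E a ε hε => ?_⟩
    · simp only [Pi.smul_apply, hμ.additive S R h, smul_add]
    · simp [hμ.support S a h]
    · obtain ⟨d, hd⟩ := hμ.bounded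
      refine ⟨‖c‖ * d, ?_⟩
      rintro r ⟨n, S, h₁, h₂, rfl⟩
      simp only [Pi.smul_apply, norm_smul, ← Finset.mul_sum]
      exact mul_le_mul_of_nonneg_left (hd ⟨n, S, h₁, h₂, rfl⟩) (norm_nonneg c)
    · have hc : 0 < ‖c‖ + 1 := by positivity
      obtain ⟨F, G, hF, hG, h⟩ := hμ.regular E a (ε / (‖c‖ + 1)) (div_pos hε hc)
      refine ⟨F, G, hF, hG, fun C hC => ?_⟩
      have e := (lt_div_iff₀ hc).1 (h C hC)
      calc ‖(c • μ) C a‖ = ‖c‖ * ‖μ C a‖ := norm_smul c (μ C a)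
        _ ≤ ‖μ C a‖ * (‖c‖ + 1) := by nlinarith [norm_nonneg (μ C a)]
        _ < ε := e

/-- The vector space of RBA AOFM of `A ≅ Γ`.  It is normed below by the total variation. -/
def RBAAOFM (φ : A ≃⋆ₐ[ℂ] Γ) : Type _ := ↥(rbaSubmodule φ)

namespace RBAAOFM

instance : AddCommGroup (RBAAOFM φ) := inferInstanceAs (AddCommGroup ↥(rbaSubmodule φ))

instance : Module ℂ (RBAAOFM φ) := inferInstanceAs (Module ℂ ↥(rbaSubmodule φ))

instance : CoeFun (RBAAOFM φ) fun _ => ClosedAlg T → StrongDual ℂ A := ⟨Subtype.val⟩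

theorem isRBAAOFM (μ : RBAAOFM φ) : IsRBAAOFM φ (μ : ClosedAlg T → StrongDual ℂ A) := μ.2

/-- The norm of an RBA AOFM is its total variation. -/
instance : Norm (RBAAOFM φ) := ⟨fun μ => sSup (variationSums μ)⟩

theorem norm_def (μ : RBAAOFM φ) : ‖μ‖ = sSup (variationSums μ) := rfl

theorem sum_le_norm (μ : RBAAOFM φ) {r : ℝ} (hr : r ∈ variationSums μ) : r ≤ ‖μ‖ :=
  le_csSup μ.isRBAAOFM.bounded hr

theorem norm_apply_le (μ : RBAAOFM φ) (S : ClosedAlg T) : ‖μ S‖ ≤ ‖μ‖ := by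
  have h : ‖μ S‖ + ‖μ ⟨(S : Set T)ᶜ, ClosedAlg.compl_mem S⟩‖ ≤ ‖μ‖ := by
    refine μ.sum_le_norm ⟨2, ![S, ⟨(S : Set T)ᶜ, ClosedAlg.compl_mem S⟩], ?_, ?_, ?_⟩
    · intro i j hij
      fin_cases i <;> fin_cases j <;> simp_all [disjoint_compl_right, disjoint_compl_left]
    · ext x
      simp [Fin.exists_fin_two, Classical.em]
    · simp [Fin.sum_univ_two]
  linarith [norm_nonneg (μ ⟨(S : Set T)ᶜ, ClosedAlg.compl_mem S⟩)]

theorem norm_nonneg' (μ : RBAAOFM φ) : 0 ≤ ‖μ‖ :=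
  (norm_nonneg _).trans (μ.norm_apply_le (ClosedAlg.whole T))

theorem norm_smul_le' (c : ℂ) (μ : RBAAOFM φ) : ‖c • μ‖ ≤ ‖c‖ * ‖μ‖ := by
  refine csSup_le (variationSums_nonempty _) ?_
  rintro r ⟨n, S, h₁, h₂, rfl⟩
  calc ∑ i, ‖(c • μ) (S i)‖ = ∑ i, ‖c‖ * ‖μ (S i)‖ :=
        Finset.sum_congr rfl fun i _ => norm_smul c (μ (S i))
    _ = ‖c‖ * ∑ i, ‖μ (S i)‖ := (Finset.mul_sum _ _ _).symm
    _ ≤ ‖c‖ * ‖μ‖ :=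
        mul_le_mul_of_nonneg_left (μ.sum_le_norm ⟨n, S, h₁, h₂, rfl⟩) (norm_nonneg c)

theorem norm_add_le' (μ ν : RBAAOFM φ) : ‖μ + ν‖ ≤ ‖μ‖ + ‖ν‖ := by
  refine csSup_le (variationSums_nonempty _) ?_
  rintro r ⟨n, S, h₁, h₂, rfl⟩
  calc ∑ i, ‖(μ + ν) (S i)‖ ≤ ∑ i, (‖μ (S i)‖ + ‖ν (S i)‖) :=
        Finset.sum_le_sum fun i _ => norm_add_le (μ (S i)) (ν (S i))
    _ ≤ ‖μ‖ + ‖ν‖ := by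
        rw [Finset.sum_add_distrib]
        exact add_le_add (μ.sum_le_norm ⟨n, S, h₁, h₂, rfl⟩) (ν.sum_le_norm ⟨n, S, h₁, h₂, rfl⟩)

theorem eq_zero_of_norm (μ : RBAAOFM φ) (h : ‖μ‖ = 0) : μ = 0 :=
  Subtype.ext <| funext fun S => norm_le_zero_iff.1 (h ▸ μ.norm_apply_le S)

theorem norm_smul_eq (c : ℂ) (μ : RBAAOFM φ) : ‖c • μ‖ = ‖c‖ * ‖μ‖ := by
  refine le_antisymm (norm_smul_le' c μ) ?_
  rcases eq_or_ne c 0 with rfl | hc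
  · simpa using norm_nonneg' ((0 : ℂ) • μ)
  · have h := norm_smul_le' c⁻¹ (c • μ)
    rw [inv_smul_smul₀ hc, norm_inv] at h
    have hc' : 0 < ‖c‖ := norm_pos_iff.2 hc
    calc ‖c‖ * ‖μ‖ ≤ ‖c‖ * (‖c‖⁻¹ * ‖c • μ‖) := mul_le_mul_of_nonneg_left h hc'.le
      _ = ‖c • μ‖ := by field_simp

theorem core : NormedSpace.Core ℂ (RBAAOFM φ) where
  norm_nonneg := norm_nonneg'
  norm_smul := norm_smul_eq
  norm_triangle := norm_add_le'
  norm_eq_zero_iff μ := ⟨eq_zero_of_norm μ, by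
    rintro rfl
    simpa using norm_smul_eq (0 : ℂ) (0 : RBAAOFM φ)⟩

instance : NormedAddCommGroup (RBAAOFM φ) := NormedAddCommGroup.ofCore core

instance : NormedSpace ℂ (RBAAOFM φ) := NormedSpace.ofCore core

end RBAAOFM

end Measures

end OperatorField

end

/-! Maximality makes `Γ` a module over the bounded continuous functions on `T`
(`IsMaximalFullAlgebra.exists_mul`). The field of the unit has norm 0 or 1 at each point, so every
field lives on the set `K` where that norm is 1, and `K` is clopen and compact. All topology
therefore takes place on a compact Hausdorff space, although `T` is only Hausdorff.

Surjectivity with norm control (`exists_rbaaofm`). For a functional `ψ` and continuous `f ≥ 0` on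
`K`, the supremum of `Re ψ b` over `b` with `‖b(t)‖ ≤ f t` is additive and positively homogeneous in
`f`. The Riesz theorem gives a measure `ρ` on `K` of mass at most `‖ψ‖` with `‖ψ b‖ ≤ ∫ ‖b(t)‖ dρ`.
Hahn–Banach extends `ψ` to a functional `Ψ` on all bounded fields, dominated by the upper integral
of the norm. Then `μ(S)(a) = Ψ(1_S a)` is additive, and the estimate `‖μ(S)‖ ≤ ρ(S ∩ K)` yields both
its variation bound and its regularity.

Injectivity (`IsRBAAOFM.eq_zero_of_whole`). Let `μ(T) = 0`. For closed `F`, take `G` around `F` from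
regularity and a cutoff `f` equal to 1 near `F ∩ K` and 0 near `K` minus the interior of `G`. Then
`μ(F)(a) = μ(F)(fa)` is, up to sign, the value at `fa` of `μ` on the interior of `G` minus `F`.
Regularity bounds `μ(D)(a)` on subsets `D` of that difference, but not `μ(D)(fa)`; a layer-cake
argument (`IsRBAAOFM.norm_apply_mul_le`) passes from `a` to `fa`. Inner regularity then extends the
vanishing from closed sets to the whole algebra.

Isometry follows: by injectivity `μ` is the measure constructed from `μ(T)`, so `‖μ‖ ≤ ‖μ(T)‖`; the
other inequality is immediate. -/

noncomputable section

namespace OperatorField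

/-! ### Local approximation and the use of maximality. -/

section Fields

variable {T : Type*} {B : T → Type*} [∀ t, NonUnitalCStarAlgebra (B t)]

theorem norm_field_apply_le (x : lp B ∞) (t : T) : ‖x t‖ ≤ ‖x‖ :=
  lp.norm_apply_le_norm ENNReal.top_ne_zero x t

variable [TopologicalSpace T]

/-- A field is locally approximable by `Γ` if near every point it is uniformly close to members
of `Γ`. -/
def LocallyApproximable (Γ : NonUnitalStarSubalgebra ℂ (lp B ∞)) (x : lp B ∞) : Prop :=
  ∀ t₀, ∀ ε : ℝ, 0 < ε → ∃ y ∈ Γ, ∀ᶠ t in 𝓝 t₀, ‖x t - y t‖ < ε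

/-- The fields vanishing at infinity that are locally uniform limits of members of `Γ`. -/
def localClosure (Γ : NonUnitalStarSubalgebra ℂ (lp B ∞)) :
    NonUnitalStarSubalgebra ℂ (lp B ∞) where
  carrier := {x | LocallyApproximable Γ x ∧ Tendsto (fun t => ‖x t‖) (cocompact T) (𝓝 0)}
  zero_mem' := ⟨fun _ ε hε => ⟨0, Γ.zero_mem, by simp [hε]⟩, by simp [tendsto_const_nhds]⟩
  add_mem' := by
    rintro x y ⟨hx, hx0⟩ ⟨hy, hy0⟩
    refine ⟨fun t₀ ε hε => ?_, ?_⟩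
    · obtain ⟨u, hu, hxu⟩ := hx t₀ (ε / 2) (half_pos hε)
      obtain ⟨v, hv, hyv⟩ := hy t₀ (ε / 2) (half_pos hε)
      refine ⟨u + v, Γ.add_mem hu hv, ?_⟩
      filter_upwards [hxu, hyv] with t h₁ h₂
      calc ‖(x + y) t - (u + v) t‖ = ‖(x t - u t) + (y t - v t)‖ := by
            simp only [lp.coeFn_add, Pi.add_apply]; congr 1; abel
        _ ≤ ‖x t - u t‖ + ‖y t - v t‖ := norm_add_le _ _
        _ < ε := by linarith
    · exact squeeze_zero (fun _ => norm_nonneg _) (fun t => norm_add_le (x t) (y t))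
        (by simpa using hx0.add hy0)
  mul_mem' := by
    rintro x y ⟨hx, hx0⟩ ⟨hy, hy0⟩
    refine ⟨fun t₀ ε hε => ?_, ?_⟩
    · have hyp : 0 < ‖y‖ + 1 := by positivity
      obtain ⟨u, hu, hxu⟩ := hx t₀ (ε / 2 / (‖y‖ + 1)) (by positivity)
      have hup : 0 < ‖u‖ + 1 := by positivity
      obtain ⟨v, hv, hyv⟩ := hy t₀ (ε / 2 / (‖u‖ + 1)) (by positivity)
      refine ⟨u * v, Γ.mul_mem hu hv, ?_⟩
      filter_upwards [hxu, hyv] with t h₁ h₂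
      rw [lt_div_iff₀ hyp] at h₁
      rw [lt_div_iff₀ hup] at h₂
      have e₁ : ‖(x t - u t) * y t‖ ≤ ‖x t - u t‖ * (‖y‖ + 1) :=
        (norm_mul_le _ _).trans (mul_le_mul_of_nonneg_left
          ((norm_field_apply_le y t).trans (by linarith)) (norm_nonneg _))
      have e₂ : ‖u t * (y t - v t)‖ ≤ ‖y t - v t‖ * (‖u‖ + 1) := by
        rw [mul_comm]
        exact (norm_mul_le _ _).trans (mul_le_mul_of_nonneg_right
          ((norm_field_apply_le u t).trans (by linarith)) (norm_nonneg _))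
      calc ‖(x * y) t - (u * v) t‖ = ‖(x t - u t) * y t + u t * (y t - v t)‖ := by
            simp only [lp.infty_coeFn_mul, Pi.mul_apply]
            congr 1; noncomm_ring
        _ ≤ ‖(x t - u t) * y t‖ + ‖u t * (y t - v t)‖ := norm_add_le _ _
        _ < ε := by linarith
    · refine squeeze_zero (fun _ => norm_nonneg _) (fun t => ?_)
        (by simpa using hx0.mul_const ‖y‖)
      exact (norm_mul_le (x t) (y t)).trans
        (mul_le_mul_of_nonneg_left (norm_field_apply_le y t) (norm_nonneg _))
  smul_mem' := by
    rintro c x ⟨hx, hx0⟩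
    refine ⟨fun t₀ ε hε => ?_, ?_⟩
    · have hc : 0 < ‖c‖ + 1 := by positivity
      obtain ⟨u, hu, hxu⟩ := hx t₀ (ε / (‖c‖ + 1)) (by positivity)
      refine ⟨c • u, Γ.smul_mem c hu, ?_⟩
      filter_upwards [hxu] with t h₁
      rw [lt_div_iff₀ hc] at h₁
      calc ‖(c • x) t - (c • u) t‖ = ‖c‖ * ‖x t - u t‖ := by
            simp only [lp.coeFn_smul, Pi.smul_apply, ← smul_sub, norm_smul]
        _ < ε := by nlinarith [norm_nonneg (x t - u t)]
    · simpa [norm_smul] using hx0.const_mul ‖c‖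
  star_mem' := by
    rintro x ⟨hx, hx0⟩
    refine ⟨fun t₀ ε hε => ?_, by simpa using hx0⟩
    obtain ⟨u, hu, hxu⟩ := hx t₀ ε hε
    refine ⟨star u, star_mem hu, ?_⟩
    filter_upwards [hxu] with t h₁
    simpa [← star_sub] using h₁

variable {Γ : NonUnitalStarSubalgebra ℂ (lp B ∞)}

/-- Near each point the norm function is uniformly close to the continuous norm function of a member
of `Γ`. -/
theorem LocallyApproximable.continuous_norm (hΓ : IsFullAlgebra Γ) {x : lp B ∞}
    (hx : LocallyApproximable Γ x) : Continuous fun t => ‖x t‖ := by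
  rw [continuous_iff_continuousAt]
  intro t₀
  rw [Metric.continuousAt_iff']
  intro ε hε
  obtain ⟨y, hy, hxy⟩ := hx t₀ (ε / 3) (by positivity)
  have hc := Metric.continuousAt_iff'.1 ((hΓ.continuous_norm y hy).continuousAt (x := t₀))
    (ε / 3) (by positivity)
  filter_upwards [hxy, hc] with t h₁ h₂
  have h₀ := hxy.self_of_nhds
  rw [Real.dist_eq, abs_lt] at *
  have e₁ := abs_le.1 (abs_norm_sub_norm_le (x t) (y t))
  have e₂ := abs_le.1 (abs_norm_sub_norm_le (x t₀) (y t₀))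
  constructor <;> linarith [e₁.1, e₁.2, e₂.1, e₂.2, h₂.1, h₂.2]

theorem le_localClosure (hΓ : IsFullAlgebra Γ) : Γ ≤ localClosure Γ := fun x hx =>
  ⟨fun _ ε hε => ⟨x, hx, by simp [hε]⟩, hΓ.vanishing x hx⟩

theorem isClosed_localClosure : IsClosed (localClosure Γ : Set (lp B ∞)) := by
  refine isClosed_of_closure_subset fun x hx => ?_
  rw [Metric.mem_closure_iff] at hx
  have key : ∀ ε : ℝ, 0 < ε → ∃ y ∈ localClosure Γ, ∀ t, ‖x t - y t‖ < ε := fun ε hε => by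
    obtain ⟨y, hy, hxy⟩ := hx ε hε
    refine ⟨y, hy, fun t => (norm_field_apply_le (x - y) t).trans_lt ?_⟩
    rwa [← dist_eq_norm]
  refine ⟨fun t₀ ε hε => ?_, ?_⟩
  · obtain ⟨y, hy, hxy⟩ := key (ε / 2) (half_pos hε)
    obtain ⟨z, hz, hyz⟩ := hy.1 t₀ (ε / 2) (half_pos hε)
    refine ⟨z, hz, ?_⟩
    filter_upwards [hyz] with t ht
    linarith [norm_sub_le_norm_sub_add_norm_sub (x t) (y t) (z t), hxy t]
  · rw [Metric.tendsto_nhds]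
    intro ε hε
    obtain ⟨y, hy, hxy⟩ := key (ε / 2) (half_pos hε)
    filter_upwards [Metric.tendsto_nhds.1 hy.2 (ε / 2) (half_pos hε)] with t ht
    simp only [dist_zero_right, norm_norm] at ht ⊢
    linarith [norm_le_norm_sub_add (x t) (y t), hxy t]

/-- Maximality enters through this fact: it forces `localClosure Γ` back into `Γ`. -/
theorem isFullAlgebra_localClosure (hΓ : IsFullAlgebra Γ) : IsFullAlgebra (localClosure Γ) where
  continuous_norm _ hx := hx.1.continuous_norm hΓ
  vanishing _ hx := hx.2
  dense_fibre t := by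
    refine (hΓ.dense_fibre t).mono ?_
    rintro _ ⟨x, hx, h⟩
    exact ⟨x, le_localClosure hΓ hx, h⟩
  complete := isClosed_localClosure.isComplete

/-- A maximal full algebra is closed under multiplication by bounded continuous functions. -/
theorem IsMaximalFullAlgebra.exists_mul (hΓ : IsMaximalFullAlgebra Γ) {g : T → ℝ}
    (hg : Continuous g) {M : ℝ} (hM : ∀ t, |g t| ≤ M) {x : lp B ∞} (hx : x ∈ Γ) :
    ∃ y ∈ Γ, ∀ t, y t = (g t : ℂ) • x t := by
  have hb : ∀ t, ‖(g t : ℂ) • x t‖ ≤ M * ‖x t‖ := fun t => by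
    rw [norm_smul, Complex.norm_real]
    exact mul_le_mul_of_nonneg_right (hM t) (norm_nonneg _)
  let y : lp B ∞ := ⟨fun t => (g t : ℂ) • x t, memℓp_infty ⟨|M| * ‖x‖, by
    rintro _ ⟨t, rfl⟩
    exact (hb t).trans (mul_le_mul (le_abs_self M) (norm_field_apply_le x t) (norm_nonneg _)
      (abs_nonneg _))⟩⟩
  have hy : ∀ t, y t = (g t : ℂ) • x t := fun _ => rfl
  refine ⟨y, hΓ.le_of_ge (isFullAlgebra_localClosure hΓ.prop) (le_localClosure hΓ.prop) ?_, hy⟩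
  -- Near `t₀` the field `g x` is close to the constant multiple `g(t₀) x`, because `g` is
  -- continuous and `x` is bounded.
  refine ⟨fun t₀ ε hε => ⟨(g t₀ : ℂ) • x, Γ.smul_mem _ hx, ?_⟩, ?_⟩
  · have hxp : 0 < ‖x‖ + 1 := by positivity
    filter_upwards [Metric.continuousAt_iff'.1 (hg.continuousAt (x := t₀)) (ε / (‖x‖ + 1))
      (by positivity)] with t ht
    rw [lt_div_iff₀ hxp, Real.dist_eq] at ht
    have : y t - ((g t₀ : ℂ) • x) t = ((g t - g t₀ : ℝ) : ℂ) • x t := by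
      rw [hy, lp.coeFn_smul, Pi.smul_apply, ← sub_smul, Complex.ofReal_sub]
    rw [this, norm_smul, Complex.norm_real, Real.norm_eq_abs]
    nlinarith [norm_field_apply_le x t, abs_nonneg (g t - g t₀)]
  · exact squeeze_zero (fun _ => norm_nonneg _) hb (by simpa using (hΓ.prop.vanishing x hx).const_mul M)

end Fields

/-! ### The clopen compact set that carries all fields. -/

section Unital

variable {T : Type*} {B : T → Type*} [∀ t, NonUnitalCStarAlgebra (B t)]
  {Γ : NonUnitalStarSubalgebra ℂ (lp B ∞)} {A : Type*} [CStarAlgebra A] (φ : A ≃⋆ₐ[ℂ] Γ)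

theorem field_add (a b : A) (t : T) :
    (φ (a + b) : lp B ∞) t = (φ a : lp B ∞) t + (φ b : lp B ∞) t := by
  rw [map_add]; rfl

theorem field_sub (a b : A) (t : T) :
    (φ (a - b) : lp B ∞) t = (φ a : lp B ∞) t - (φ b : lp B ∞) t := by
  rw [map_sub]; rfl

theorem field_smul (c : ℂ) (a : A) (t : T) :
    (φ (c • a) : lp B ∞) t = c • (φ a : lp B ∞) t := by
  rw [map_smul]; rfl

theorem field_mul (a b : A) (t : T) :
    (φ (a * b) : lp B ∞) t = (φ a : lp B ∞) t * (φ b : lp B ∞) t := by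
  rw [map_mul]; rfl

theorem field_star (a : A) (t : T) :
    (φ (star a) : lp B ∞) t = star ((φ a : lp B ∞) t) := by
  rw [map_star]; rfl

theorem norm_field (a : A) : ‖(φ a : lp B ∞)‖ = ‖a‖ :=
  NonUnitalStarAlgHom.norm_map
    ((NonUnitalStarSubalgebraClass.subtype Γ).comp (φ : A →⋆ₙₐ[ℂ] Γ))
    (Subtype.val_injective.comp φ.injective) a

theorem norm_field_le (a : A) (t : T) : ‖(φ a : lp B ∞) t‖ ≤ ‖a‖ :=
  (norm_field_apply_le _ t).trans (norm_field φ a).le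

theorem norm_le_of_field {a : A} {C : ℝ} (hC : 0 ≤ C) (h : ∀ t, ‖(φ a : lp B ∞) t‖ ≤ C) :
    ‖a‖ ≤ C :=
  (norm_field φ a).ge.trans (lp.norm_le_of_forall_le hC h)

/-- The set of points where the identity of `A` does not vanish. -/
def carrierSet : Set T := {t | (φ 1 : lp B ∞) t ≠ 0}

theorem field_eq_zero {t : T} (ht : t ∉ carrierSet φ) (a : A) : (φ a : lp B ∞) t = 0 := by
  have h : (φ 1 : lp B ∞) t = 0 := not_not.1 ht
  rw [← one_mul a, field_mul, h, zero_mul]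

/-- The value of the unit at `t` is a projection, so by the C*-identity its norm equals its own
square. -/
theorem norm_field_one {t : T} (ht : t ∈ carrierSet φ) : ‖(φ 1 : lp B ∞) t‖ = 1 := by
  have h : ‖(φ 1 : lp B ∞) t‖ = ‖(φ 1 : lp B ∞) t‖ * ‖(φ 1 : lp B ∞) t‖ := by
    rw [← CStarRing.norm_star_mul_self, ← field_star, ← field_mul, star_one, one_mul]
  have h0 : ‖(φ 1 : lp B ∞) t‖ ≠ 0 := norm_ne_zero_iff.2 ht
  exact (mul_left_cancel₀ h0 (by rw [mul_one]; exact h)).symm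

variable [TopologicalSpace T]

theorem exists_field_mul (hΓ : IsMaximalFullAlgebra Γ) {g : T → ℝ}
    (hg : Continuous g) {M : ℝ} (hM : ∀ t, |g t| ≤ M) (a : A) :
    ∃ b : A, ∀ t, (φ b : lp B ∞) t = (g t : ℂ) • (φ a : lp B ∞) t := by
  obtain ⟨y, hy, h⟩ := hΓ.exists_mul hg hM (φ a).2
  exact ⟨φ.symm ⟨y, hy⟩, fun t => by simp [h]⟩

theorem continuous_norm_field (hΓ : IsFullAlgebra Γ) (a : A) :
    Continuous fun t => ‖(φ a : lp B ∞) t‖ := hΓ.continuous_norm _ (φ a).2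

theorem isClopen_carrierSet (hΓ : IsFullAlgebra Γ) : IsClopen (carrierSet φ) := by
  have hc := continuous_norm_field φ hΓ (1 : A)
  refine ⟨?_, ?_⟩
  · convert isClosed_singleton.preimage hc (t := {(1 : ℝ)}) using 1
    ext t
    exact ⟨fun h => norm_field_one φ h, fun h h0 => by simp [h0] at h⟩
  · convert (isOpen_compl_singleton (x := (0 : ℝ))).preimage hc using 1
    ext t
    simp [carrierSet]

/-- The norm of the unit field is 1 on this set and yet vanishes at infinity. -/
theorem isCompact_carrierSet (hΓ : IsFullAlgebra Γ) : IsCompact (carrierSet φ) := by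
  have h := (hΓ.vanishing _ (φ 1).2).eventually (gt_mem_nhds one_pos)
  obtain ⟨K, hK, hKs⟩ := mem_cocompact.1 h
  refine hK.of_isClosed_subset (isClopen_carrierSet φ hΓ).1 fun t ht => ?_
  by_contra hn
  exact (hKs hn : ‖(φ 1 : lp B ∞) t‖ < 1).ne (norm_field_one φ ht)

end Unital

/-- Extension by zero of a continuous function on a clopen subset. -/
theorem continuous_extend_zero {T : Type*} [TopologicalSpace T] {K : Set T} (hK : IsClopen K)
    {f : K → ℝ} (hf : Continuous f) :
    Continuous (Function.extend (Subtype.val : K → T) f 0) := by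
  rw [continuous_iff_continuousAt]
  intro t
  by_cases ht : t ∈ K
  · have := (hK.2.isOpenEmbedding_subtypeVal.continuousAt_iff (x := ⟨t, ht⟩)
      (g := Function.extend (Subtype.val : K → T) f 0)).1
    refine this ?_
    rw [Function.extend_comp Subtype.val_injective]
    exact hf.continuousAt
  · have : Function.extend (Subtype.val : K → T) f 0 =ᶠ[𝓝 t] fun _ => 0 := by
      filter_upwards [hK.1.isOpen_compl.mem_nhds ht] with s hs
      rw [Function.extend_apply', Pi.zero_apply]
      rintro ⟨k, rfl⟩
      exact hs k.2
    exact continuousAt_const.congr this.symm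

section

open scoped NNReal CompactlySupported

/-! ### The additive functional on positive functions attached to `ψ`. -/

section Domination

variable {T : Type*} {B : T → Type*} [∀ t, NonUnitalCStarAlgebra (B t)]
  {Γ : NonUnitalStarSubalgebra ℂ (lp B ∞)} {A : Type*} [CStarAlgebra A] (φ : A ≃⋆ₐ[ℂ] Γ)
  (ψ : StrongDual ℂ A)

/-- The elements of `A` whose fields are dominated in norm by `f`. -/
def dominated (f : carrierSet φ → ℝ≥0) : Set A := {b | ∀ t : carrierSet φ, ‖(φ b : lp B ∞) t‖ ≤ f t}

theorem zero_mem_dominated (f : carrierSet φ → ℝ≥0) : (0 : A) ∈ dominated φ f := fun t => by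
  simp

theorem norm_le_of_mem_dominated {f : carrierSet φ → ℝ≥0} {C : ℝ≥0} (hC : ∀ t, f t ≤ C) {b : A}
    (hb : b ∈ dominated φ f) : ‖b‖ ≤ C := by
  refine norm_le_of_field φ C.2 fun t => ?_
  by_cases ht : t ∈ carrierSet φ
  · exact (hb ⟨t, ht⟩).trans (NNReal.coe_le_coe.2 (hC _))
  · rw [field_eq_zero φ ht, norm_zero]
    exact C.2

theorem re_le_of_mem_dominated {f : carrierSet φ → ℝ≥0} {C : ℝ≥0} (hC : ∀ t, f t ≤ C) {b : A}
    (hb : b ∈ dominated φ f) : (ψ b).re ≤ ‖ψ‖ * C :=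
  (Complex.re_le_norm _).trans ((ψ.le_opNorm b).trans
    (mul_le_mul_of_nonneg_left (norm_le_of_mem_dominated φ hC hb) (norm_nonneg ψ)))

/-- The largest real part that `ψ` takes on elements dominated by `f`. -/
def dominationSup (f : carrierSet φ → ℝ≥0) : ℝ := sSup ((fun b => (ψ b).re) '' dominated φ f)

theorem le_dominationSup {f : carrierSet φ → ℝ≥0} {C : ℝ≥0} (hC : ∀ t, f t ≤ C) {b : A}
    (hb : b ∈ dominated φ f) : (ψ b).re ≤ dominationSup φ ψ f := by
  refine le_csSup ⟨‖ψ‖ * C, ?_⟩ ⟨b, hb, rfl⟩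
  rintro _ ⟨b, hb, rfl⟩
  exact re_le_of_mem_dominated φ ψ hC hb

theorem dominationSup_le {f : carrierSet φ → ℝ≥0} {r : ℝ}
    (h : ∀ b ∈ dominated φ f, (ψ b).re ≤ r) : dominationSup φ ψ f ≤ r := by
  refine csSup_le ⟨_, 0, zero_mem_dominated φ f, rfl⟩ ?_
  rintro _ ⟨b, hb, rfl⟩
  exact h b hb

theorem dominationSup_nonneg {f : carrierSet φ → ℝ≥0} {C : ℝ≥0} (hC : ∀ t, f t ≤ C) :
    0 ≤ dominationSup φ ψ f := by
  simpa using le_dominationSup φ ψ hC (zero_mem_dominated φ f)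

/-- Domination is unaffected by unimodular scalars, and one of them rotates `ψ b` onto its modulus.
-/
theorem norm_le_dominationSup {f : carrierSet φ → ℝ≥0} {C : ℝ≥0} (hC : ∀ t, f t ≤ C) {b : A}
    (hb : b ∈ dominated φ f) : ‖ψ b‖ ≤ dominationSup φ ψ f := by
  obtain ⟨c, hc, h⟩ : ∃ c : ℂ, ‖c‖ = 1 ∧ (‖ψ b‖ : ℂ) = c * ψ b := by
    obtain ⟨c, hc, h⟩ := RCLike.exists_norm_mul_eq_self (ψ b)
    refine ⟨star c, by simpa using hc, ?_⟩
    conv_rhs => rw [← h]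
    have : star c * c = 1 := by
      rw [Complex.star_def, Complex.conj_mul', hc]; simp
    rw [← mul_assoc, this, one_mul]; rfl
  have hm : c • b ∈ dominated φ f := fun t => by
    rw [field_smul, norm_smul, hc, one_mul]
    exact hb t
  have := le_dominationSup φ ψ hC hm
  rwa [map_smul, smul_eq_mul, ← h, Complex.ofReal_re] at this

theorem mul_dominationSup_le {f : carrierSet φ → ℝ≥0} {C : ℝ≥0} (hC : ∀ t, f t ≤ C) (c : ℝ≥0) :
    c * dominationSup φ ψ f ≤ dominationSup φ ψ (fun t => c * f t) := by
  have hC' : ∀ t, c * f t ≤ c * C := fun t => mul_le_mul_right (hC t) c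
  rcases eq_or_ne c 0 with rfl | hc
  · simpa using dominationSup_nonneg φ ψ hC'
  · have hcp : (0 : ℝ) < c := by positivity
    rw [← le_div_iff₀' hcp]
    refine dominationSup_le φ ψ fun b hb => ?_
    rw [le_div_iff₀' hcp]
    have hm : ((c : ℝ) : ℂ) • b ∈ dominated φ (fun t => c * f t) := fun t => by
      rw [field_smul, norm_smul, Complex.norm_real, Real.norm_of_nonneg c.coe_nonneg, NNReal.coe_mul]
      exact mul_le_mul_of_nonneg_left (hb t) c.2
    have := le_dominationSup φ ψ hC' hm
    rwa [map_smul, smul_eq_mul, Complex.re_ofReal_mul] at this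

theorem dominationSup_mul {f : carrierSet φ → ℝ≥0} {C : ℝ≥0} (hC : ∀ t, f t ≤ C) (c : ℝ≥0) :
    dominationSup φ ψ (fun t => c * f t) = c * dominationSup φ ψ f := by
  refine le_antisymm ?_ (mul_dominationSup_le φ ψ hC c)
  have hC' : ∀ t, c * f t ≤ c * C := fun t => mul_le_mul_right (hC t) c
  rcases eq_or_ne c 0 with rfl | hc
  · refine dominationSup_le φ ψ fun b hb => ?_
    simpa using re_le_of_mem_dominated φ ψ (C := 0) (by simp) hb
  · have hcp : (0 : ℝ) < c := by positivity
    have h := mul_dominationSup_le φ ψ hC' c⁻¹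
    simp only [inv_mul_cancel_left₀ hc, NNReal.coe_inv] at h
    rwa [inv_mul_le_iff₀ hcp] at h

theorem dominationSup_add_ge {f g : carrierSet φ → ℝ≥0} {C D : ℝ≥0} (hC : ∀ t, f t ≤ C)
    (hD : ∀ t, g t ≤ D) :
    dominationSup φ ψ f + dominationSup φ ψ g ≤ dominationSup φ ψ (fun t => f t + g t) := by
  rw [← le_sub_iff_add_le]
  refine dominationSup_le φ ψ fun b hb => ?_
  rw [le_sub_comm]
  refine dominationSup_le φ ψ fun b' hb' => ?_
  rw [le_sub_iff_add_le]
  have hm : b' + b ∈ dominated φ (fun t => f t + g t) := fun t => by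
    rw [field_add, NNReal.coe_add, add_comm (f t : ℝ)]
    exact (norm_add_le _ _).trans (add_le_add (hb' t) (hb t))
  have := le_dominationSup φ ψ (fun t => add_le_add (hC t) (hD t)) hm
  rwa [map_add, Complex.add_re] at this

variable {φ} [TopologicalSpace T]

theorem compactSpace_carrierSet (hΓ : IsFullAlgebra Γ) : CompactSpace (carrierSet φ) :=
  isCompact_iff_compactSpace.1 (isCompact_carrierSet φ hΓ)

theorem exists_field_mul_of_continuous (hΓ : IsMaximalFullAlgebra Γ) {g : carrierSet φ → ℝ}
    (hg : Continuous g) (a : A) :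
    ∃ b : A, ∀ t : carrierSet φ, (φ b : lp B ∞) t = (g t : ℂ) • (φ a : lp B ∞) t := by
  have := compactSpace_carrierSet (φ := φ) hΓ.prop
  obtain ⟨M, hM⟩ := (isCompact_univ.image hg.abs).bddAbove
  have hM' : ∀ t, |g t| ≤ M := fun t => hM ⟨t, trivial, rfl⟩
  obtain ⟨b, hb⟩ := exists_field_mul φ hΓ (continuous_extend_zero (isClopen_carrierSet φ hΓ.prop) hg)
    (M := |M|) (fun t => by
      by_cases ht : t ∈ carrierSet φ
      · rw [show t = ((⟨t, ht⟩ : carrierSet φ) : T) from rfl, Subtype.val_injective.extend_apply]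
        exact (hM' _).trans (le_abs_self M)
      · rw [Function.extend_apply' _ _ _ (by rintro ⟨k, rfl⟩; exact ht k.2)]
        simp) a
  exact ⟨b, fun t => by rw [hb, Subtype.val_injective.extend_apply]⟩

/-- An element dominated by `f + g` is split with the weights `f/(f+g+ε)`, `g/(f+g+ε)` and
`ε/(f+g+ε)`. The term `ε` keeps the denominator positive; the third piece has norm at most `ε`, so
it contributes at most `‖ψ‖ ε ≤ δ`. -/
theorem dominationSup_add_le (hΓ : IsMaximalFullAlgebra Γ) {f g : carrierSet φ → ℝ≥0} {C D : ℝ≥0}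
    (hC : ∀ t, f t ≤ C) (hD : ∀ t, g t ≤ D) (hf : Continuous f) (hg : Continuous g) :
    dominationSup φ ψ (fun t => f t + g t) ≤ dominationSup φ ψ f + dominationSup φ ψ g := by
  refine dominationSup_le φ ψ fun b hb => ?_
  refine le_of_forall_pos_le_add fun δ hδ => ?_
  have hψ : 0 < ‖ψ‖ + 1 := by positivity
  obtain ⟨ε, hε, hεδ⟩ : ∃ ε : ℝ≥0, 0 < ε ∧ ‖ψ‖ * ε ≤ δ := by
    refine ⟨(δ / (‖ψ‖ + 1)).toNNReal, Real.toNNReal_pos.2 (div_pos hδ hψ), ?_⟩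
    rw [Real.coe_toNNReal _ (div_pos hδ hψ).le, mul_div_assoc', div_le_iff₀ hψ]
    nlinarith [norm_nonneg ψ]
  have hpos : ∀ t, (0 : ℝ) < f t + g t + ε := fun t => by positivity
  have hcont : ∀ {u : carrierSet φ → ℝ≥0}, Continuous u →
      Continuous fun t => (u t : ℝ) / (f t + g t + ε) := fun hu =>
    (by fun_prop : Continuous fun t => (_ : ℝ)).div (by fun_prop) fun t => (hpos t).ne'
  have hsplit : ∀ {u : carrierSet φ → ℝ≥0}, Continuous u → ∃ b' : A, b' ∈ dominated φ u ∧
      ∀ t : carrierSet φ, (φ b' : lp B ∞) t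
        = ((u t / (f t + g t + ε) : ℝ) : ℂ) • (φ b : lp B ∞) t := fun {u} hu => by
    obtain ⟨b', hb'⟩ := exists_field_mul_of_continuous hΓ (hcont hu) b
    refine ⟨b', fun t => ?_, hb'⟩
    have h1 := hb t
    rw [NNReal.coe_add] at h1
    rw [hb', norm_smul, Complex.norm_real, Real.norm_of_nonneg (by positivity), div_mul_eq_mul_div,
      div_le_iff₀ (hpos t)]
    exact mul_le_mul_of_nonneg_left (by linarith [ε.2]) (u t).2
  obtain ⟨b₁, h₁, e₁⟩ := hsplit hf
  obtain ⟨b₂, h₂, e₂⟩ := hsplit hg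
  have h₃ : b - b₁ - b₂ ∈ dominated φ (fun _ => ε) := fun t => by
    have h1 := hb t
    rw [NNReal.coe_add] at h1
    have : (φ (b - b₁ - b₂) : lp B ∞) t
        = ((ε / (f t + g t + ε) : ℝ) : ℂ) • (φ b : lp B ∞) t := by
      rw [field_sub, field_sub, e₁, e₂]
      nth_rw 1 [← one_smul ℂ ((φ b : lp B ∞) t)]
      rw [← sub_smul, ← sub_smul]
      congr 1
      rw [← Complex.ofReal_one, ← Complex.ofReal_sub, ← Complex.ofReal_sub]
      congr 1
      have := (hpos t).ne'
      field_simp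
      ring
    rw [this, norm_smul, Complex.norm_real, Real.norm_of_nonneg (by positivity), div_mul_eq_mul_div,
      div_le_iff₀ (hpos t)]
    exact mul_le_mul_of_nonneg_left (by linarith [ε.2]) ε.2
  have k₁ := le_dominationSup φ ψ hC h₁
  have k₂ := le_dominationSup φ ψ hD h₂
  have k₃ := re_le_of_mem_dominated φ ψ (C := ε) (fun _ => le_rfl) h₃
  simp only [map_sub, Complex.sub_re] at k₃
  linarith

end Domination

/-! ### The Riesz measure dominating a functional. -/

section RieszMeasure

variable {T : Type*} [TopologicalSpace T] [T2Space T] {B : T → Type*}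
  [∀ t, NonUnitalCStarAlgebra (B t)]
  {Γ : NonUnitalStarSubalgebra ℂ (lp B ∞)} {A : Type*} [CStarAlgebra A] {φ : A ≃⋆ₐ[ℂ] Γ}

/-- The Riesz measure of `dominationSup`: the mass bound comes from `f = 1`, the domination from
taking `f` to be the norm function of `b`. -/
theorem exists_measure_of_functional [MeasurableSpace (carrierSet φ)] [BorelSpace (carrierSet φ)]
    (hΓ : IsMaximalFullAlgebra Γ) (ψ : StrongDual ℂ A) :
    ∃ ρ : Measure (carrierSet φ), ρ.Regular ∧ ρ univ ≤ ‖ψ‖ₑ ∧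
      ∀ b : A, ‖ψ b‖ₑ ≤ ∫⁻ t, ‖(φ b : lp B ∞) t‖ₑ ∂ρ := by
  have := compactSpace_carrierSet (φ := φ) hΓ.prop
  have hbdd : ∀ f : C_c(carrierSet φ, ℝ≥0), ∃ C : ℝ≥0, ∀ t, f t ≤ C := fun f => by
    obtain ⟨C, hC⟩ := (isCompact_univ.image f.continuous).bddAbove
    exact ⟨C, fun t => hC ⟨t, trivial, rfl⟩⟩
  let L : C_c(carrierSet φ, ℝ≥0) →ₗ[ℝ≥0] ℝ≥0 :=
    { toFun f := ⟨dominationSup φ ψ f, (hbdd f).elim fun _ hC => dominationSup_nonneg φ ψ hC⟩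
      map_add' f g := by
        obtain ⟨C, hC⟩ := hbdd f
        obtain ⟨D, hD⟩ := hbdd g
        exact NNReal.eq (le_antisymm (dominationSup_add_le ψ hΓ hC hD f.continuous g.continuous)
          (dominationSup_add_ge φ ψ hC hD))
      map_smul' c f := (hbdd f).elim fun _ hC => NNReal.eq (dominationSup_mul φ ψ hC c) }
  have hL : ∀ f : carrierSet φ → ℝ≥0, Continuous f → ∀ C : ℝ≥0, (∀ t, f t ≤ C) →
      ∫⁻ t, f t ∂(NNRealRMK.rieszMeasure L) = ENNReal.ofReal (dominationSup φ ψ f) := by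
    intro f hf C hC
    let f' : C_c(carrierSet φ, ℝ≥0) := ⟨⟨f, hf⟩, HasCompactSupport.of_compactSpace f⟩
    have := NNRealRMK.lintegral_rieszMeasure L f'
    refine this.trans ?_
    rw [ENNReal.ofReal, Real.toNNReal_of_nonneg (dominationSup_nonneg φ ψ hC)]
    rfl
  refine ⟨NNRealRMK.rieszMeasure L, inferInstance, ?_, fun b => ?_⟩
  · have h := hL (fun _ => 1) continuous_const 1 (fun _ => le_rfl)
    simp only [ENNReal.coe_one, lintegral_const, one_mul] at h
    rw [h, ← ofReal_norm]
    refine ENNReal.ofReal_le_ofReal (dominationSup_le φ ψ fun b hb => ?_)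
    simpa using re_le_of_mem_dominated φ ψ (C := 1) (fun _ => le_rfl) hb
  · have hc : Continuous fun t : carrierSet φ => ‖(φ b : lp B ∞) t‖₊ :=
      ((continuous_norm_field φ hΓ.prop b).comp continuous_subtype_val).subtype_mk _
    have hC : ∀ t : carrierSet φ, ‖(φ b : lp B ∞) t‖₊ ≤ ‖b‖₊ := fun t => norm_field_le φ b t
    have h := hL _ hc ‖b‖₊ hC
    rw [← ofReal_norm]
    refine le_trans ?_ h.ge
    exact ENNReal.ofReal_le_ofReal (norm_le_dominationSup φ ψ hC fun t => le_rfl)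

end RieszMeasure

end

/-- The complex Hahn–Banach theorem for a seminorm. -/
theorem exists_extension_of_le_seminorm {E : Type*} [AddCommGroup E] [Module ℂ E]
    (p : Seminorm ℂ E) (W : Submodule ℂ E) (f : W →ₗ[ℂ] ℂ) (hf : ∀ x : W, ‖f x‖ ≤ p x) :
    ∃ g : E →ₗ[ℂ] ℂ, (∀ x : W, g x = f x) ∧ ∀ x, ‖g x‖ ≤ p x := by
  let fr : E →ₗ.[ℝ] ℝ :=
    ⟨W.restrictScalars ℝ, Complex.reLm.comp (f.restrictScalars ℝ)⟩
  obtain ⟨g, hg, hgp⟩ := exists_extension_of_le_sublinear fr p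
    (fun c hc x => by
      rw [← Complex.coe_smul c x, map_smul_eq_mul, Complex.norm_real, Real.norm_of_nonneg hc.le])
    (map_add_le_add p) (fun x => (Complex.re_le_norm _).trans (hf x))
  have hre : ∀ x, (Module.Dual.extendRCLike (𝕜 := ℂ) g x : ℂ).re = g x := fun x =>
    Module.Dual.re_extendRCLike_apply (𝕜 := ℂ) g x
  refine ⟨Module.Dual.extendRCLike (𝕜 := ℂ) g, fun x => ?_, fun x => ?_⟩
  · have e : ∀ y : W, (Module.Dual.extendRCLike (𝕜 := ℂ) g (y : E) : ℂ).re = (f y).re := fun y =>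
      (hre y).trans (hg y)
    refine Complex.ext (e x) ?_
    -- Imaginary parts agree because `Re f(ix) = -Im f(x)`.
    have h := e (Complex.I • x)
    rw [Submodule.coe_smul, map_smul, map_smul] at h
    simpa using h
  · obtain ⟨c, hc, h⟩ := RCLike.exists_norm_mul_eq_self (Module.Dual.extendRCLike (𝕜 := ℂ) g x : ℂ)
    have hc0 : star c * c = 1 := by rw [Complex.star_def, Complex.conj_mul', hc]; simp
    have h' : (Module.Dual.extendRCLike (𝕜 := ℂ) g (star c • x) : ℂ) = (‖Module.Dual.extendRCLike (𝕜 := ℂ) g x‖ : ℂ) := by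
      rw [map_smul, smul_eq_mul]
      conv_lhs => rw [← h]
      rw [← mul_assoc, hc0, one_mul]
      rfl
    have := hre (star c • x)
    rw [h', Complex.ofReal_re] at this
    rw [this]
    refine (hgp _).trans ?_
    rw [map_smul_eq_mul, norm_star, hc, one_mul]

/-! ### The upper integral as a seminorm on all bounded fields. -/

section UpperIntegral

variable {T : Type*} {B : T → Type*} [∀ t, NonUnitalCStarAlgebra (B t)] {K : Set T}
  [MeasurableSpace K] (ρ : Measure K)

/-- The upper integral over `K` of the norm of a bounded operator field. -/
def upperIntegral (x : lp B ∞) : ℝ≥0∞ :=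
  ⨅ g : {g : K → ℝ≥0∞ // Measurable g ∧ ∀ t : K, ‖x t‖ₑ ≤ g t}, ∫⁻ t, g.1 t ∂ρ

theorem upperIntegral_le {x : lp B ∞} {g : K → ℝ≥0∞} (hg : Measurable g)
    (h : ∀ t : K, ‖x t‖ₑ ≤ g t) : upperIntegral ρ x ≤ ∫⁻ t, g t ∂ρ :=
  iInf_le (fun g : {g : K → ℝ≥0∞ // Measurable g ∧ ∀ t : K, ‖x t‖ₑ ≤ g t} => ∫⁻ t, g.1 t ∂ρ)
    ⟨g, hg, h⟩

theorem lintegral_le_upperIntegral (x : lp B ∞) : ∫⁻ t : K, ‖x t‖ₑ ∂ρ ≤ upperIntegral ρ x :=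
  le_iInf fun g => lintegral_mono g.2.2

/-- Majorants add, and their measurability makes the integrals add. This is the reason for an upper
integral: the norm of an arbitrary bounded field need not be measurable. -/
theorem upperIntegral_add_le (x y : lp B ∞) :
    upperIntegral ρ (x + y) ≤ upperIntegral ρ x + upperIntegral ρ y := by
  refine ENNReal.le_iInf_add_iInf fun g h => ?_
  rw [← lintegral_add_left g.2.1]
  exact upperIntegral_le ρ (g.2.1.add h.2.1) fun t =>
    (enorm_add_le (x t) (y t)).trans (add_le_add (g.2.2 t) (h.2.2 t))

theorem upperIntegral_smul_le (c : ℂ) (x : lp B ∞) :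
    upperIntegral ρ (c • x) ≤ ‖c‖ₑ * upperIntegral ρ x := by
  have hx : ∀ t, ‖(c • x) t‖ₑ = ‖c‖ₑ * ‖x t‖ₑ := fun t => enorm_smul c (x t)
  rcases eq_or_ne c 0 with rfl | hc
  · refine (upperIntegral_le ρ measurable_zero fun t => ?_).trans ?_
    · simp
    · simp
  · rw [upperIntegral, upperIntegral, ENNReal.mul_iInf_of_ne (by simpa) enorm_ne_top]
    refine le_iInf fun g => ?_
    rw [← lintegral_const_mul _ g.2.1]
    exact upperIntegral_le ρ (g.2.1.const_mul _) fun t => by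
      rw [hx]
      exact mul_le_mul_right (g.2.2 t) _

theorem upperIntegral_le_indicator {x : lp B ∞} {C : ℝ≥0∞} {S : Set T}
    (hS : MeasurableSet ((↑) ⁻¹' S : Set K)) (hC : ∀ t : K, ‖x t‖ₑ ≤ C) (h0 : ∀ t ∉ S, x t = 0) :
    upperIntegral ρ x ≤ C * ρ ((↑) ⁻¹' S) := by
  rw [← lintegral_indicator_const hS]
  refine upperIntegral_le ρ (measurable_const.indicator hS) fun t => ?_
  by_cases ht : (t : T) ∈ S
  · rw [indicator_of_mem (show t ∈ (↑) ⁻¹' S from ht)]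
    exact hC t
  · simp [h0 t ht]

theorem upperIntegral_le_norm (x : lp B ∞) : upperIntegral ρ x ≤ ‖x‖ₑ * ρ univ :=
  upperIntegral_le_indicator ρ (S := univ) .univ
    (fun t => enorm_le_iff_norm_le.2 (norm_field_apply_le x t)) (by simp)

theorem upperIntegral_ne_top [IsFiniteMeasure ρ] (x : lp B ∞) : upperIntegral ρ x ≠ ⊤ :=
  ((upperIntegral_le_norm ρ x).trans_lt
    (ENNReal.mul_lt_top enorm_lt_top (measure_lt_top _ _))).ne

/-- The upper integral as a seminorm. -/
def upperSeminorm [IsFiniteMeasure ρ] : Seminorm ℂ (lp B ∞) :=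
  Seminorm.ofSMulLE (fun x => (upperIntegral ρ x).toReal)
    (by
      have := upperIntegral_le_norm ρ (0 : lp B ∞)
      simp only [enorm_zero, zero_mul, nonpos_iff_eq_zero] at this
      simp [this])
    (fun x y => by
      rw [← ENNReal.toReal_add (upperIntegral_ne_top ρ x) (upperIntegral_ne_top ρ y)]
      exact ENNReal.toReal_mono (by simp [upperIntegral_ne_top]) (upperIntegral_add_le ρ x y))
    (fun c x => by
      rw [← toReal_enorm c, ← ENNReal.toReal_mul]
      exact ENNReal.toReal_mono (ENNReal.mul_ne_top enorm_ne_top (upperIntegral_ne_top ρ x))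
        (upperIntegral_smul_le ρ c x))

end UpperIntegral

/-! ### Cutting fields off to subsets. -/

section Restrict

variable {T : Type*} {B : T → Type*} [∀ t, NonUnitalCStarAlgebra (B t)]

open Classical in
/-- The operator field that agrees with `x` on `S` and vanishes elsewhere. -/
def restrictField (S : Set T) : lp B ∞ →ₗ[ℂ] lp B ∞ where
  toFun x := ⟨fun t => if t ∈ S then x t else 0, memℓp_infty ⟨‖x‖, by
    rintro _ ⟨t, rfl⟩
    dsimp only
    split_ifs
    · exact norm_field_apply_le x t
    · simp⟩⟩
  map_add' x y := lp.ext <| funext fun t => by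
    change (if t ∈ S then x t + y t else 0)
      = (if t ∈ S then x t else 0) + (if t ∈ S then y t else 0)
    split_ifs <;> simp
  map_smul' c x := lp.ext <| funext fun t => by
    change (if t ∈ S then c • x t else 0) = c • (if t ∈ S then x t else 0)
    split_ifs <;> simp

theorem restrictField_of_mem {S : Set T} {t : T} (ht : t ∈ S) (x : lp B ∞) :
    restrictField S x t = x t := if_pos ht

theorem restrictField_of_notMem {S : Set T} {t : T} (ht : t ∉ S) (x : lp B ∞) :
    restrictField S x t = 0 := if_neg ht

theorem norm_restrictField_apply_le (S : Set T) (x : lp B ∞) (t : T) :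
    ‖restrictField S x t‖ ≤ ‖x t‖ := by
  by_cases ht : t ∈ S
  · rw [restrictField_of_mem ht]
  · rw [restrictField_of_notMem ht, norm_zero]
    exact norm_nonneg _

theorem restrictField_union {S R : Set T} (h : Disjoint S R) (x : lp B ∞) :
    restrictField (S ∪ R) x = restrictField S x + restrictField R x := by
  refine lp.ext (funext fun t => ?_)
  rw [lp.coeFn_add, Pi.add_apply]
  by_cases hS : t ∈ S
  · rw [restrictField_of_mem (mem_union_left R hS), restrictField_of_mem hS,
      restrictField_of_notMem (h.notMem_of_mem_left hS), add_zero]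
  · by_cases hR : t ∈ R
    · rw [restrictField_of_mem (mem_union_right S hR), restrictField_of_mem hR, restrictField_of_notMem hS,
        zero_add]
    · rw [restrictField_of_notMem (by simp [hS, hR]), restrictField_of_notMem hS,
        restrictField_of_notMem hR, zero_add]

theorem restrictField_univ (x : lp B ∞) : restrictField univ x = x :=
  lp.ext (funext fun _ => restrictField_of_mem (mem_univ _) x)

end Restrict

theorem ClosedAlg.measurableSet_preimage {T : Type*} [TopologicalSpace T] {K : Set T}
    [MeasurableSpace K] [BorelSpace K] {S : Set T} (hS : S ∈ ClosedAlg T) :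
    MeasurableSet ((↑) ⁻¹' S : Set K) := by
  induction hS with
  | base s hs => exact (IsClosed.preimage continuous_subtype_val hs).measurableSet
  | empty => exact .empty
  | compl s _ ih => exact ih.compl
  | union s t _ _ ihs iht => exact ihs.union iht

theorem ClosedAlg.mem_of_isClosed {T : Type*} [TopologicalSpace T] {S : Set T} (hS : IsClosed S) :
    S ∈ ClosedAlg T :=
  self_subset_generateSetAlgebra hS

theorem ClosedAlg.mem_of_isOpen {T : Type*} [TopologicalSpace T] {S : Set T} (hS : IsOpen S) :
    S ∈ ClosedAlg T := by
  simpa using ClosedAlg.compl_mem ⟨Sᶜ, ClosedAlg.mem_of_isClosed hS.isClosed_compl⟩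

/-! ### Every functional is the total mass of a measure. -/

section Existence

variable {T : Type*} [TopologicalSpace T] [T2Space T] {B : T → Type*}
  [∀ t, NonUnitalCStarAlgebra (B t)]
  {Γ : NonUnitalStarSubalgebra ℂ (lp B ∞)} {A : Type*} [CStarAlgebra A] {φ : A ≃⋆ₐ[ℂ] Γ}

/-- A functional extended to all bounded fields, evaluated at restrictions of members of `Γ`. -/
def restrictedFunctional (φ : A ≃⋆ₐ[ℂ] Γ) (Ψ : lp B ∞ →ₗ[ℂ] ℂ) (C : ℝ)
    (hΨ : ∀ x, ‖Ψ x‖ ≤ C * ‖x‖) (S : Set T) : StrongDual ℂ A :=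
  LinearMap.mkContinuous
    { toFun a := Ψ (restrictField S (φ a : lp B ∞))
      map_add' a b := by rw [map_add, NonUnitalStarSubalgebra.coe_add, map_add, map_add]
      map_smul' c a := by
        rw [map_smul, NonUnitalStarSubalgebra.coe_smul, map_smul, map_smul, RingHom.id_apply] }
    |C| fun a => (hΨ _).trans <| mul_le_mul (le_abs_self C)
      (lp.norm_le_of_forall_le (norm_nonneg a) fun t =>
        (norm_restrictField_apply_le S _ t).trans (norm_field_le φ a t))
      (norm_nonneg _) (abs_nonneg C)

theorem exists_rbaaofm (hΓ : IsMaximalFullAlgebra Γ) (ψ : StrongDual ℂ A) :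
    ∃ μ : RBAAOFM φ, μ (ClosedAlg.whole T) = ψ ∧ ‖μ‖ ≤ ‖ψ‖ := by
  let _ : MeasurableSpace (carrierSet φ) := borel _
  have : BorelSpace (carrierSet φ) := ⟨rfl⟩
  have := compactSpace_carrierSet (φ := φ) hΓ.prop
  obtain ⟨ρ, hρ, hρψ, hψ⟩ := exists_measure_of_functional (φ := φ) hΓ ψ
  have hρfin : IsFiniteMeasure ρ := ⟨hρψ.trans_lt enorm_lt_top⟩
  have hρreal : ρ.real univ ≤ ‖ψ‖ := by
    rw [← toReal_enorm ψ]
    exact ENNReal.toReal_mono enorm_ne_top hρψ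
  obtain ⟨Ψ, hΨψ, hΨ⟩ : ∃ Ψ : lp B ∞ →ₗ[ℂ] ℂ, (∀ a : A, Ψ (φ a : lp B ∞) = ψ a) ∧
      ∀ x, ‖Ψ x‖ ≤ upperSeminorm ρ x := by
    obtain ⟨g, hg, hgp⟩ := exists_extension_of_le_seminorm (upperSeminorm ρ) Γ.toSubmodule
      { toFun x := ψ (φ.symm x)
        map_add' x y := (congrArg ψ (map_add φ.symm x y)).trans (map_add ψ _ _)
        map_smul' c x := (congrArg ψ (map_smul φ.symm c x)).trans (map_smul ψ _ _) }
      (fun x => by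
        have h := (hψ (φ.symm x)).trans (lintegral_le_upperIntegral ρ _)
        have h2 := ENNReal.toReal_mono (upperIntegral_ne_top ρ _) h
        rw [toReal_enorm, φ.apply_symm_apply] at h2
        exact h2)
    refine ⟨g, fun a => ?_, hgp⟩
    exact (hg (φ a)).trans (congrArg ψ (φ.symm_apply_apply a))
  have hΨn : ∀ x, ‖Ψ x‖ ≤ ρ.real univ * ‖x‖ := fun x => by
    have h := ENNReal.toReal_mono
      (ENNReal.mul_ne_top enorm_ne_top (measure_ne_top _ _)) (upperIntegral_le_norm ρ x)
    rw [ENNReal.toReal_mul, toReal_enorm, mul_comm] at h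
    exact (hΨ x).trans h
  let m : ClosedAlg T → StrongDual ℂ A := fun S => restrictedFunctional φ Ψ _ hΨn S
  have hm : ∀ S a, m S a = Ψ (restrictField S (φ a : lp B ∞)) := fun _ _ => rfl
  have hmS : ∀ (S : ClosedAlg T) (a : A),
      ‖m S a‖ ≤ ρ.real ((↑) ⁻¹' (S : Set T)) * ‖a‖ := fun S a => by
    have h := ENNReal.toReal_mono
      (ENNReal.mul_ne_top enorm_ne_top (measure_ne_top _ _))
      (upperIntegral_le_indicator ρ (x := restrictField S (φ a : lp B ∞)) (C := ‖a‖ₑ)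
        (ClosedAlg.measurableSet_preimage S.2)
        (fun t => enorm_le_iff_norm_le.2
          ((norm_restrictField_apply_le _ _ _).trans (norm_field_le φ a t)))
        (fun t ht => restrictField_of_notMem ht _))
    rw [ENNReal.toReal_mul, toReal_enorm, mul_comm] at h
    exact (hΨ _).trans h
  have hmn : ∀ S : ClosedAlg T, ‖m S‖ ≤ ρ.real ((↑) ⁻¹' (S : Set T)) := fun S =>
    ContinuousLinearMap.opNorm_le_bound _ measureReal_nonneg (hmS S)
  have hvar : ∀ r ∈ variationSums m, r ≤ ‖ψ‖ := by
    rintro _ ⟨n, S, hd, -, rfl⟩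
    refine (Finset.sum_le_sum fun i _ => hmn (S i)).trans ?_
    rw [← measureReal_iUnion_fintype (fun i j hij => (hd i j hij).preimage _)
      (fun i => ClosedAlg.measurableSet_preimage (S i).2)]
    exact (measureReal_mono (subset_univ _)).trans hρreal
  have hmeas : IsRBAAOFM φ m :=
    { additive S R h := by
        ext a
        simp only [add_apply, hm]
        rw [restrictField_union h, map_add]
      support S a h := by
        have : restrictField S (φ a : lp B ∞) = 0 := by
          refine lp.ext (funext fun t => ?_)
          by_cases ht : t ∈ (S : Set T)
          · rw [restrictField_of_mem ht]
            by_contra h0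
            exact notMem_empty t (h ▸ ⟨subset_closure h0, ht⟩)
          · rw [restrictField_of_notMem ht]; rfl
        rw [hm, this, map_zero]
      bounded := ⟨‖ψ‖, hvar⟩
      regular E a ε hε := by
        have hE : MeasurableSet ((↑) ⁻¹' (E : Set T) : Set (carrierSet φ)) :=
          ClosedAlg.measurableSet_preimage E.2
        -- The set `G \ F` will split into two pieces, inside and outside `E`, each of measure less
        -- than `δ`.
        obtain ⟨δ, hδ, hδε⟩ : ∃ δ : ℝ, 0 < δ ∧ (δ + δ) * ‖a‖ < ε := by
          refine ⟨ε / 2 / (‖a‖ + 1), by positivity, ?_⟩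
          rw [← add_div, add_halves, div_mul_eq_mul_div, div_lt_iff₀ (by positivity)]
          nlinarith [norm_nonneg a]
        have hδ' : ENNReal.ofReal δ ≠ 0 := (ENNReal.ofReal_pos.2 hδ).ne'
        obtain ⟨F, hFE, hFc, hF⟩ := hE.exists_isClosed_sdiff_lt (measure_ne_top ρ _) hδ'
        obtain ⟨G, hEG, hGo, -, hG⟩ := hE.exists_isOpen_sdiff_lt (measure_ne_top ρ _) hδ'
        have hK := isClopen_carrierSet φ hΓ.prop
        have hFT : IsClosed ((↑) '' F : Set T) := hK.1.isClosedMap_subtype_val F hFc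
        -- Points of `E` off the carrier must also be interior to the outer set; adding the whole
        -- complement costs nothing, as `ρ` lives on the carrier.
        have hGT : IsOpen ((↑) '' G ∪ (carrierSet φ)ᶜ : Set T) :=
          (hK.2.isOpenMap_subtype_val G hGo).union hK.1.isOpen_compl
        refine ⟨⟨_, ClosedAlg.mem_of_isClosed hFT⟩, ⟨_, ClosedAlg.mem_of_isOpen hGT⟩, ?_, ?_, ?_⟩
        · rw [hFT.closure_eq]
          exact image_subset_iff.2 hFE
        · rw [hGT.interior_eq]
          intro t ht
          by_cases htK : t ∈ carrierSet φ
          · exact Or.inl ⟨⟨t, htK⟩, hEG ht, rfl⟩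
          · exact Or.inr htK
        · intro C hC
          refine (hmS C a).trans_lt (lt_of_le_of_lt ?_ hδε)
          refine mul_le_mul_of_nonneg_right ?_ (norm_nonneg a)
          have hsub : ((↑) ⁻¹' (C : Set T) : Set (carrierSet φ)) ⊆
              ((↑) ⁻¹' (E : Set T) \ F) ∪ (G \ (↑) ⁻¹' (E : Set T)) := by
            intro t ht
            obtain ⟨h1, h2⟩ := hC ht
            have hF' : t ∉ F := fun h => h2 ⟨t, h, rfl⟩
            have hG' : t ∈ G := by
              rcases h1 with ⟨s, hs, hst⟩ | h1
              · rwa [← Subtype.ext hst]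
              · exact (h1 t.2).elim
            by_cases htE : (t : T) ∈ (E : Set T)
            · exact Or.inl ⟨htE, hF'⟩
            · exact Or.inr ⟨hG', htE⟩
          refine (measureReal_mono hsub).trans ((measureReal_union_le _ _).trans ?_)
          exact add_le_add (ENNReal.toReal_le_of_le_ofReal hδ.le hF.le)
            (ENNReal.toReal_le_of_le_ofReal hδ.le hG.le) }
  refine ⟨⟨m, hmeas⟩, ?_, csSup_le (variationSums_nonempty m) hvar⟩
  ext a
  exact (congrArg Ψ (restrictField_univ _)).trans (hΨψ a)

end Existence

/-! ### Uniqueness: a measure of zero total mass vanishes. -/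

theorem ClosedAlg.sdiff_mem {T : Type*} [TopologicalSpace T] (S R : ClosedAlg T) :
    (S : Set T) \ R ∈ ClosedAlg T :=
  isSetAlgebra_generateSetAlgebra.sdiff_mem S.2 R.2

/-- Abel summation, for rewriting a sum over level slices as a sum over superlevel sets. -/
theorem sum_mul_sub_succ (u : ℕ → ℂ) (n : ℕ) :
    ∑ j ∈ Finset.range (n + 1), (j : ℂ) * (u j - u (j + 1))
      = ∑ j ∈ Finset.range n, u (j + 1) - n * u (n + 1) := by
  induction n with
  | zero => simp
  | succ n ih =>
    rw [Finset.sum_range_succ, ih, Finset.sum_range_succ]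
    push_cast
    ring

namespace IsRBAAOFM

variable {T : Type*} [TopologicalSpace T] {B : T → Type*} [∀ t, NonUnitalCStarAlgebra (B t)]
  {Γ : NonUnitalStarSubalgebra ℂ (lp B ∞)} {A : Type*} [CStarAlgebra A] {φ : A ≃⋆ₐ[ℂ] Γ}
  {μ : ClosedAlg T → StrongDual ℂ A}

theorem apply_empty (hμ : IsRBAAOFM φ μ) : μ ⟨∅, ClosedAlg.empty_mem⟩ = 0 := by
  have h := hμ.additive ⟨∅, ClosedAlg.empty_mem⟩ ⟨∅, ClosedAlg.empty_mem⟩ (by simp)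
  simpa using h

theorem apply_eq_add_sdiff (hμ : IsRBAAOFM φ μ) {S R : ClosedAlg T} (h : (R : Set T) ⊆ S) :
    μ S = μ R + μ ⟨S \ R, ClosedAlg.sdiff_mem S R⟩ := by
  rw [← hμ.additive R ⟨S \ R, ClosedAlg.sdiff_mem S R⟩ disjoint_sdiff_self_right]
  congr 1
  exact Subtype.ext (union_sdiff_cancel h).symm

/-- The complement of the union completes the disjoint family to a partition. -/
theorem sum_norm_le (hμ : IsRBAAOFM φ μ) {n : ℕ} (D : Fin n → ClosedAlg T)
    (hD : ∀ i j, i ≠ j → Disjoint (D i : Set T) (D j)) :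
    ∑ i, ‖μ (D i)‖ ≤ sSup (variationSums μ) := by
  have hU : (⋃ i, (D i : Set T)) ∈ ClosedAlg T := by
    simpa using isSetAlgebra_generateSetAlgebra.biUnion_mem (s := fun i => (D i : Set T))
      Finset.univ fun i _ => (D i).2
  let R : ClosedAlg T := ⟨(⋃ i, (D i : Set T))ᶜ, ClosedAlg.compl_mem ⟨_, hU⟩⟩
  have hR : ∀ i, Disjoint (R : Set T) (D i) := fun i =>
    disjoint_compl_left.mono_right (subset_iUnion (fun i => (D i : Set T)) i)
  have h := le_csSup hμ.bounded (a := ∑ i, ‖μ ((Fin.cons R D : Fin (n + 1) → ClosedAlg T) i)‖)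
    ⟨n + 1, Fin.cons R D, fun i j => by
      refine Fin.cases ?_ (fun i => ?_) i <;> refine Fin.cases ?_ (fun j => ?_) j
      · simp
      · exact fun _ => by simpa using hR j
      · exact fun _ => by simpa using (hR i).symm
      · simpa using hD i j, by
      rw [iUnion_eq_univ_iff]
      intro t
      by_cases ht : t ∈ (R : Set T)
      · exact ⟨0, by simpa⟩
      · obtain ⟨i, hi⟩ := mem_iUnion.1 (not_not.1 ht)
        exact ⟨i.succ, by simpa⟩, rfl⟩
  rw [Fin.sum_univ_succ] at h
  simp only [Fin.cons_zero, Fin.cons_succ] at h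
  linarith [norm_nonneg (μ R)]

/-- The support of `a - b` lies in the closed set `P`, which misses `S`. -/
theorem apply_eq_of_eqOn_compl_closed (hμ : IsRBAAOFM φ μ) {S : ClosedAlg T} {P : Set T}
    (hP : IsClosed P) (hPS : Disjoint P S) {a b : A}
    (h : ∀ t ∉ P, (φ a : lp B ∞) t = (φ b : lp B ∞) t) : μ S a = μ S b := by
  rw [← sub_eq_zero, ← map_sub]
  refine hμ.support S _ (disjoint_iff_inter_eq_empty.1 (hPS.mono_left ?_))
  refine closure_minimal (fun t ht => ?_) hP
  by_contra hn
  exact ht (by rw [field_sub, h t hn, sub_self])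

/-- Truncating `g` to `[-r, r]` changes the field only inside the closed set `{|g| ≥ r}`. The strict
bound on `S` keeps this set disjoint from `S`, so `μ S` does not see the change. -/
theorem norm_apply_le_of_abs_lt (hΓ : IsMaximalFullAlgebra Γ) (hμ : IsRBAAOFM φ μ)
    {S : ClosedAlg T} {g : T → ℝ} (hg : Continuous g) {r : ℝ} (hr : 0 ≤ r)
    (hgr : ∀ t ∈ (S : Set T), |g t| < r) {a b : A}
    (hb : ∀ t, (φ b : lp B ∞) t = (g t : ℂ) • (φ a : lp B ∞) t) :
    ‖μ S b‖ ≤ r * ‖a‖ * ‖μ S‖ := by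
  have habs : ∀ t, |max (-r) (min r (g t))| ≤ r := fun t =>
    abs_le.2 ⟨le_max_left _ _, max_le (by linarith) (min_le_left _ _)⟩
  obtain ⟨c, hc⟩ := exists_field_mul φ hΓ (g := fun t => max (-r) (min r (g t)))
    (by fun_prop) habs a
  have hcn : ‖c‖ ≤ r * ‖a‖ := norm_le_of_field φ (by positivity) fun t => by
    rw [hc, norm_smul, Complex.norm_real]
    exact mul_le_mul (habs t) (norm_field_le φ a t) (norm_nonneg _) hr
  rw [hμ.apply_eq_of_eqOn_compl_closed (b := c) (isClosed_le continuous_const hg.abs)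
    (P := {t | r ≤ |g t|}) (disjoint_left.2 fun t ht hS => (hgr t hS).not_ge ht)]
  · rw [mul_comm]
    exact ((μ S).le_opNorm c).trans (mul_le_mul_of_nonneg_left hcn (norm_nonneg _))
  · intro t ht
    have h := abs_lt.1 (not_le.1 (show ¬ r ≤ |g t| from fun h => ht h))
    rw [hb, hc, min_eq_right h.2.le, max_eq_right h.1.le]

/-- Layer cake: `f` is nearly the average of the indicators of `{f ≥ j/n}` for `1 ≤ j ≤ n`. Hence
`μ(C)(fa)` is nearly an average of the numbers `μ(C ∩ {f ≥ j/n})(a)`, each of modulus at most `ε`.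
The variation of `μ` controls only the discretization error. -/
theorem norm_apply_mul_le (hΓ : IsMaximalFullAlgebra Γ) (hμ : IsRBAAOFM φ μ) {C : ClosedAlg T}
    {f : T → ℝ} (hf : Continuous f) (hf0 : ∀ t, 0 ≤ f t) (hf1 : ∀ t, f t ≤ 1) {a b : A}
    (hb : ∀ t, (φ b : lp B ∞) t = (f t : ℂ) • (φ a : lp B ∞) t) {ε : ℝ}
    (hε : ∀ D : ClosedAlg T, (D : Set T) ⊆ C → ‖μ D a‖ ≤ ε) : ‖μ C b‖ ≤ ε := by
  set V := sSup (variationSums μ)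
  refine le_of_forall_pos_le_add fun δ hδ => ?_
  -- Enough levels to bring the total error `(2/n) ‖a‖ V` below `δ`; the maximum with 0 makes `n`
  -- positive.
  obtain ⟨n, hn⟩ := exists_nat_gt (max 0 (2 * ‖a‖ * V / δ))
  have hn0 : (0 : ℝ) < n := (le_max_left _ _).trans_lt hn
  have hnδ : 2 / n * ‖a‖ * V ≤ δ := by
    have h := ((le_max_right _ _).trans_lt hn).le
    rw [div_le_iff₀ hδ] at h
    rw [div_mul_eq_mul_div, div_mul_eq_mul_div, div_le_iff₀ hn0]
    linarith
  have hLm : ∀ j : ℕ, {t | (j : ℝ) / n ≤ f t} ∈ ClosedAlg T := fun j =>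
    ClosedAlg.mem_of_isClosed (isClosed_le continuous_const hf)
  let L : ℕ → ClosedAlg T := fun j => ⟨C ∩ {t | (j : ℝ) / n ≤ f t},
    ClosedAlg.inter_mem C ⟨_, hLm j⟩⟩
  have hL : ∀ j t, t ∈ (L j : Set T) ↔ t ∈ (C : Set T) ∧ (j : ℝ) / n ≤ f t := fun _ _ => Iff.rfl
  have hanti : ∀ i j, i ≤ j → (L j : Set T) ⊆ L i := fun i j hij t ht =>
    ⟨ht.1, (div_le_div_of_nonneg_right (Nat.cast_le.2 hij) hn0.le).trans ht.2⟩
  let D : ℕ → ClosedAlg T := fun j => ⟨L j \ L (j + 1), ClosedAlg.sdiff_mem _ _⟩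
  have hD : ∀ j, μ (D j) = μ (L j) - μ (L (j + 1)) := fun j =>
    eq_sub_of_add_eq' (hμ.apply_eq_add_sdiff (hanti j (j + 1) j.le_succ)).symm
  have hL0 : L 0 = C := Subtype.ext <| by
    ext t
    simp [hL, hf0]
  have hLn : μ (L (n + 1)) = 0 := by
    rw [← hμ.apply_empty]
    congr 1
    refine Subtype.ext (eq_empty_of_forall_notMem fun t ht => ?_)
    have h1 := ((hL _ _).1 ht).2
    rw [div_le_iff₀ hn0] at h1
    push_cast at h1
    nlinarith [hf1 t]
  have hDdisj : ∀ i j : Fin (n + 1), i ≠ j → Disjoint (D i : Set T) (D j) := by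
    have key : ∀ i j : ℕ, i < j → Disjoint (D i : Set T) (D j) := fun i j hij =>
      disjoint_left.2 fun t hi hj => hi.2 (hanti _ _ hij hj.1)
    intro i j hij
    rcases lt_or_gt_of_ne (Fin.val_injective.ne hij) with h | h
    · exact key _ _ h
    · exact (key _ _ h).symm
  have hsum : ∑ j ∈ Finset.range (n + 1), ‖μ (D j)‖ ≤ V := by
    rw [Finset.sum_range]
    exact hμ.sum_norm_le (fun i : Fin (n + 1) => D i) hDdisj
  -- On the slice `D j` one has `0 ≤ f - j/n < 1/n`; the factor 2 is slack.
  have hterm : ∀ j : ℕ, ‖μ (D j) b - (j / n : ℂ) * μ (D j) a‖ ≤ 2 / n * ‖a‖ * ‖μ (D j)‖ := by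
    intro j
    have hfield : ∀ t, (φ (b - ((j : ℝ) / n : ℝ) • a) : lp B ∞) t
        = ((f t - j / n : ℝ) : ℂ) • (φ a : lp B ∞) t := fun t => by
      rw [← Complex.coe_smul, field_sub, field_smul, hb, ← sub_smul, Complex.ofReal_sub]
    have h := norm_apply_le_of_abs_lt hΓ hμ (S := D j) (g := fun t => f t - j / n) (by fun_prop)
      (r := 2 / n) (by positivity) (fun t ht => by
        have h1 := ((hL _ _).1 ht.1).2
        have h2 : f t < ((j + 1 : ℕ) : ℝ) / n := by
          by_contra hn
          exact ht.2 ⟨ht.1.1, not_lt.1 hn⟩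
        rw [abs_of_nonneg (by linarith)]
        push_cast at h2
        rw [add_div] at h2
        have : (1 : ℝ) / n < 2 / n := by gcongr; norm_num
        linarith) hfield
    rw [map_sub, ← Complex.coe_smul, map_smul, smul_eq_mul] at h
    simpa using h
  have hb' : μ C b = ∑ j ∈ Finset.range (n + 1), μ (D j) b := by
    simp only [hD, sub_apply]
    rw [Finset.sum_range_sub' (fun j => μ (L j) b), hLn, hL0]
    simp
  -- The boundary term of the Abel summation disappears because `L (n + 1)` is empty, as `f ≤ 1`.
  have ha' : ∑ j ∈ Finset.range (n + 1), (j / n : ℂ) * μ (D j) a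
      = (n : ℂ)⁻¹ * ∑ j ∈ Finset.range n, μ (L (j + 1)) a := by
    have h := sum_mul_sub_succ (fun j => μ (L j) a) n
    rw [hLn, zero_apply, mul_zero, sub_zero] at h
    rw [← h, Finset.mul_sum]
    refine Finset.sum_congr rfl fun j _ => ?_
    rw [hD, sub_apply]
    ring
  have h₁ : ‖∑ j ∈ Finset.range (n + 1), (μ (D j) b - (j / n : ℂ) * μ (D j) a)‖ ≤ δ := by
    refine (norm_sum_le _ _).trans ((Finset.sum_le_sum fun j _ => hterm j).trans ?_)
    rw [← Finset.mul_sum]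
    exact (mul_le_mul_of_nonneg_left hsum (by positivity)).trans hnδ
  have h₂ : ‖(n : ℂ)⁻¹ * ∑ j ∈ Finset.range n, μ (L (j + 1)) a‖ ≤ ε := by
    rw [norm_mul, norm_inv, Complex.norm_natCast, inv_mul_le_iff₀ hn0]
    refine (norm_sum_le _ _).trans
      ((Finset.sum_le_sum fun j _ => hε (L (j + 1)) fun t ht => ht.1).trans ?_)
    simp
  rw [Finset.sum_sub_distrib, ← hb', ha'] at h₁
  linarith [norm_le_norm_sub_add (μ C b) ((n : ℂ)⁻¹ * ∑ j ∈ Finset.range n, μ (L (j + 1)) a)]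

/-- Urysohn's lemma is applied on the compact carrier. For the cutoff element `b`, the identity `0 =
μ(T)(b)` splits over `F`, `U \ F` and the complement of `U`; the last part is zero and the middle
one is small. -/
theorem norm_apply_isClosed_le [T2Space T] (hΓ : IsMaximalFullAlgebra Γ) (hμ : IsRBAAOFM φ μ)
    (h0 : μ (ClosedAlg.whole T) = 0) {F : ClosedAlg T} (hF : IsClosed (F : Set T)) (a : A) {ε : ℝ}
    (hε : 0 < ε) : ‖μ F a‖ ≤ ε := by
  obtain ⟨F₁, G, hF₁, hG, hFG⟩ := hμ.regular F a ε hε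
  have hK := isClopen_carrierSet φ hΓ.prop
  have := compactSpace_carrierSet (φ := φ) hΓ.prop
  obtain ⟨h', hh0, hh1, hh⟩ := exists_continuous_zero_one_of_isClosed
    (X := carrierSet φ) (s := (↑) ⁻¹' (interior (G : Set T))ᶜ) (t := (↑) ⁻¹' (F : Set T))
    (isOpen_interior.isClosed_compl.preimage continuous_subtype_val)
    (hF.preimage continuous_subtype_val)
    (Disjoint.preimage _ (disjoint_compl_left.mono_right hG))
  let h : T → ℝ := Function.extend Subtype.val h' 0
  have hh' : ∀ t : carrierSet φ, h t = h' t := fun t => Subtype.val_injective.extend_apply _ _ t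
  have hc : Continuous h := continuous_extend_zero hK h'.continuous
  -- Equal to 1 where `h ≥ 2/3` and to 0 where `h ≤ 1/3`. The margins are needed because supports
  -- are closures: `h` itself need not be constant near the two closed sets.
  let f : T → ℝ := fun t => max 0 (min 1 (3 * h t - 1))
  have hfc : Continuous f := by fun_prop
  have hf0 : ∀ t, 0 ≤ f t := fun t => le_max_left _ _
  have hf1 : ∀ t, f t ≤ 1 := fun t => max_le zero_le_one (min_le_left _ _)
  obtain ⟨b, hb⟩ := exists_field_mul φ hΓ hfc
    (fun t => abs_le.2 ⟨by linarith [hf0 t], hf1 t⟩) a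
  let U : ClosedAlg T := ⟨interior (G : Set T), ClosedAlg.mem_of_isOpen isOpen_interior⟩
  have e₁ : μ F a = μ F b := by
    -- The intersection with the carrier matters: `h` is 0 off it, where `F` may have points, but
    -- all fields vanish there.
    refine hμ.apply_eq_of_eqOn_compl_closed (P := carrierSet φ ∩ {t | h t ≤ 2 / 3})
      (hK.1.inter (isClosed_le hc continuous_const)) (disjoint_left.2 ?_) fun t ht => ?_
    · rintro t ⟨htK, ht⟩ htF
      have h1 : h t = 1 := (hh' ⟨t, htK⟩).trans (hh1 (show (⟨t, htK⟩ : carrierSet φ) ∈ _ from htF))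
      rw [mem_ofPred_eq, h1] at ht
      norm_num at ht
    · by_cases htK : t ∈ carrierSet φ
      · have h1 : 2 / 3 < h t := not_le.1 fun h => ht ⟨htK, h⟩
        have : f t = 1 := by
          simp only [f]
          rw [min_eq_left (by linarith), max_eq_right zero_le_one]
        rw [hb, this, Complex.ofReal_one, one_smul]
      · rw [field_eq_zero φ htK, field_eq_zero φ htK]
  have e₂ : μ ⟨ClosedAlg.whole T \ U, ClosedAlg.sdiff_mem _ _⟩ b = 0 := by
    rw [← map_zero (μ ⟨ClosedAlg.whole T \ U, ClosedAlg.sdiff_mem _ _⟩)]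
    refine hμ.apply_eq_of_eqOn_compl_closed (P := carrierSet φ ∩ {t | 1 / 3 ≤ h t})
      (hK.1.inter (isClosed_le continuous_const hc)) (disjoint_left.2 ?_) fun t ht => ?_
    · rintro t ⟨htK, ht⟩ htU
      have h1 : h t = 0 := (hh' ⟨t, htK⟩).trans
        (hh0 (show (⟨t, htK⟩ : carrierSet φ) ∈ _ from htU.2))
      rw [mem_ofPred_eq, h1] at ht
      norm_num at ht
    · rw [map_zero]
      by_cases htK : t ∈ carrierSet φ
      · have h1 : h t < 1 / 3 := not_le.1 fun h => ht ⟨htK, h⟩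
        have : f t = 0 := by
          simp only [f]
          rw [max_eq_left ((min_le_right _ _).trans (by linarith))]
        rw [hb, this, Complex.ofReal_zero, zero_smul]
        rfl
      · rw [field_eq_zero φ htK]
        rfl
  have e₃ := congrArg (fun ν : StrongDual ℂ A => ν b)
    (hμ.apply_eq_add_sdiff (S := ClosedAlg.whole T) (R := U) (subset_univ _))
  rw [hμ.apply_eq_add_sdiff (S := U) (R := F) hG, h0] at e₃
  simp only [add_apply, zero_apply, e₂, add_zero] at e₃
  rw [e₁, eq_neg_of_add_eq_zero_left e₃.symm, norm_neg]
  refine norm_apply_mul_le hΓ hμ hfc hf0 hf1 hb fun D hD => (hFG D fun t ht => ?_).le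
  exact ⟨interior_subset (hD ht).1, fun h => (hD ht).2 (hF₁ (subset_closure h))⟩

/-- Inner regularity: `S` differs from the closed set `closure F` by a subset of `G \ F`, on which
`μ` is small at `a`. -/
theorem eq_zero_of_whole [T2Space T] (hΓ : IsMaximalFullAlgebra Γ) (hμ : IsRBAAOFM φ μ)
    (h0 : μ (ClosedAlg.whole T) = 0) : μ = 0 := by
  ext S a
  refine norm_le_zero_iff.1 (le_of_forall_pos_le_add fun ε hε => ?_)
  obtain ⟨F, G, hF, hG, hFG⟩ := hμ.regular S a (ε / 2) (half_pos hε)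
  let F' : ClosedAlg T := ⟨closure F, ClosedAlg.mem_of_isClosed isClosed_closure⟩
  have h₁ := norm_apply_isClosed_le hΓ hμ h0 (F := F') isClosed_closure a (half_pos hε)
  have h₂ := hFG ⟨S \ F', ClosedAlg.sdiff_mem S F'⟩ fun t ht =>
    ⟨interior_subset (hG ht.1), fun h => ht.2 (subset_closure h)⟩
  rw [hμ.apply_eq_add_sdiff (S := S) (R := F') hF, add_apply]
  linarith [norm_add_le (μ F' a) (μ ⟨S \ F', ClosedAlg.sdiff_mem S F'⟩ a)]

end IsRBAAOFM

end OperatorField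

end

theorem mainTheorem8 {T : Type*} [TopologicalSpace T] [T2Space T]
    {B : T → Type*} [∀ t, NonUnitalCStarAlgebra (B t)]
    (Γ : NonUnitalStarSubalgebra ℂ (lp B ∞)) (hΓ : OperatorField.IsMaximalFullAlgebra Γ)
    {A : Type*} [CStarAlgebra A] [TopologicalSpace.SeparableSpace A] (φ : A ≃⋆ₐ[ℂ] Γ) :
    ∃ e : OperatorField.RBAAOFM φ ≃ₗᵢ[ℂ] StrongDual ℂ A,
      ∀ μ : OperatorField.RBAAOFM φ, e μ = μ (OperatorField.ClosedAlg.whole T) := by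
  let l : OperatorField.RBAAOFM φ →ₗ[ℂ] StrongDual ℂ A :=
    { toFun μ := μ (OperatorField.ClosedAlg.whole T)
      map_add' _ _ := rfl
      map_smul' _ _ := rfl }
  have hl : ∀ μ, l μ = 0 → μ = 0 := fun μ h =>
    Subtype.ext (μ.isRBAAOFM.eq_zero_of_whole hΓ h)
  have hnorm : ∀ μ, ‖l μ‖ = ‖μ‖ := fun μ => by
    refine le_antisymm (μ.norm_apply_le _) ?_
    -- The measure constructed from `l μ` has norm at most `‖l μ‖`, and injectivity identifies it
    -- with `μ`.
    obtain ⟨ν, hν, hle⟩ := OperatorField.exists_rbaaofm hΓ (l μ)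
    have : μ = ν := sub_eq_zero.1 (hl _ (by rw [map_sub, sub_eq_zero]; exact hν.symm))
    rwa [this] at hle ⊢
  refine ⟨LinearIsometryEquiv.ofSurjective ⟨l, hnorm⟩ fun ψ => ?_, fun μ => rfl⟩
  obtain ⟨ν, hν, -⟩ := OperatorField.exists_rbaaofm hΓ ψ
  exact ⟨ν, hν⟩
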